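/- Let $n\ge 1$ and let $\mathcal H=\bigotimes_{i=1}^n\mathcal H_i$ be a tensor product of finite-dimensional complex Hilbert spaces. A product state is a nonzero (not necessarily normalized) vector of the form $\varphi_1\otimes\cdots\otimes\varphi_n$. An orthogonal product set (OPS) in $\mathcal H$ is a set $\mathcal S$ of pairwise orthogonal product states; it is incomplete if $\dim\operatorname{span}\mathcal S<\dim\mathcal H$, and it is an orthogonal product basis (OPB) of $\mathcal H$ if it spans $\mathcal H$. An incomplete OPS $\mathcal S$ is called an unextendible product basis (UPB) if $(\operatorname{span}\mathcal S)^{\perp}$ contains no product state; an uncompletable product basis (UCPB) if no OPB of $\mathcal H$ contains $\mathcal S$; and a strongly uncompletable product basis (SUCPB) if $\mathcal S$ is a UCPB in $\mathcal H$ and in every locally extended space $\bigotimes_{i=1}^n(\mathcal H_i\oplus\mathcal H_i')$ with finite-dimensional $\mathcal H_i'$. Theorem. For all integers $d_1,d_2,d_3,d_4\ge 3$ there is a UPB $\mathcal S$ in the four-partite space $\mathbb C^{d_1}\otimes\mathbb C^{d_2}\otimes\mathbb C^{d_3}\otimes\mathbb C^{d_4}$ which is an SUCPB in every bipartition: for every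 partition $\{1,2,3,4\}=P\sqcup Q$ into two nonempty sets (both the types $1|3$ and $2|2$), the same set $\mathcal S$, regarded as a subset of the bipartite space $\bigl(\bigotimes_{i\in P}\mathbb C^{d_i}\bigr)\otimes\bigl(\bigotimes_{i\in Q}\mathbb C^{d_i}\bigr)$, is an SUCPB. -/

import Mathlib

/-- The tensor product `⨂ᵢ ℂ^(X i)` of the local spaces `ℂ^(X i)`, in coordinates: a vector is its
family of amplitudes on the computational basis states `|x⟩ = ⨂ᵢ |xᵢ⟩`, with the standard
Hermitian inner product. -/
abbrev TensorSpace {ι : Type*} [Fintype ι] [DecidableEq ι] (X : ι → Type*) [∀ i, Fintype (X i)] :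
    Type _ :=
  EuclideanSpace ℂ (∀ i, X i)

section Basic

variable {ι : Type*} [Fintype ι] [DecidableEq ι] {X : ι → Type*} [∀ i, Fintype (X i)]

/-- The product vector `⨂ᵢ φᵢ`. -/
def productVector (φ : ∀ i, EuclideanSpace ℂ (X i)) : TensorSpace X :=
  WithLp.toLp 2 fun x => ∏ i, φ i (x i)

/-- A (not necessarily normalized) product state: a nonzero product vector. -/
def IsProductState (v : TensorSpace X) : Prop :=
  v ≠ 0 ∧ ∃ φ : ∀ i, EuclideanSpace ℂ (X i), v = productVector φ

/-- Orthogonal product set (OPS): a set of pairwise orthogonal product states. -/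
def IsOPS (S : Set (TensorSpace X)) : Prop :=
  (∀ v ∈ S, IsProductState v) ∧ S.Pairwise fun v w => inner ℂ v w = 0

/-- Orthogonal product basis (OPB): an OPS that spans the whole space. -/
def IsOPB (S : Set (TensorSpace X)) : Prop :=
  IsOPS S ∧ Submodule.span ℂ S = ⊤

/-- An incomplete OPS: one whose span has dimension less than that of the whole space. -/
def IsIncompleteOPS (S : Set (TensorSpace X)) : Prop :=
  IsOPS S ∧ Module.finrank ℂ (Submodule.span ℂ S) < Module.finrank ℂ (TensorSpace X)

/-- Unextendible product basis (UPB): an incomplete OPS such that the orthogonal complement of its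
span contains no product state. -/
def IsUPB (S : Set (TensorSpace X)) : Prop :=
  IsIncompleteOPS S ∧ ∀ v ∈ (Submodule.span ℂ S)ᗮ, ¬ IsProductState v

/-- Uncompletable product basis (UCPB): an incomplete OPS that is not contained in any OPB. -/
def IsUCPB (S : Set (TensorSpace X)) : Prop :=
  IsIncompleteOPS S ∧ ¬ ∃ T : Set (TensorSpace X), S ⊆ T ∧ IsOPB T

/-- The canonical embedding of `⨂ᵢ ℂ^(X i)` into the locally extended space
`⨂ᵢ (ℂ^(X i) ⊕ ℂ^(X' i)) = ⨂ᵢ ℂ^(X i ⊕ X' i)`: the amplitudes are kept on the old basis states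
and are zero on every basis state that has some component in a local extension. -/
def localExtend {X' : ι → Type*} [∀ i, Fintype (X' i)] (v : TensorSpace X) :
    TensorSpace fun i => X i ⊕ X' i :=
  WithLp.toLp 2 fun y =>
    if h : ∀ i, (y i).isLeft = true then v fun i => (y i).getLeft (h i) else 0

/-- Strongly uncompletable product basis (SUCPB): an OPS that is a UCPB, and is still a UCPB in
every locally extended space `⨂ᵢ (ℂ^(X i) ⊕ ℂ^(m i))`. -/
def IsSUCPB (S : Set (TensorSpace X)) : Prop :=
  IsUCPB S ∧
    ∀ m : ι → ℕ, IsUCPB (localExtend (X' := fun i => Fin (m i)) '' S)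

/-- Grouping the parties `ι` into new parties `κ` along `f : ι → κ`: the new party `k` holds the
systems of all `i` with `f i = k`, so its local space is `⨂_{f i = k} ℂ^(X i)`, and the vector is
the same one, with its amplitudes reindexed by the basis states of the new parties. -/
def regroup {κ : Type*} [Fintype κ] [DecidableEq κ] (f : ι → κ) (v : TensorSpace X) :
    TensorSpace fun k : κ => ∀ i : {i : ι // f i = k}, X i :=
  WithLp.toLp 2 fun y => v fun i => y (f i) ⟨i, rfl⟩

end Basic

/-! Tile `{0,1,2}⁴` by seventeen boxes and enlarge the last block of each coordinate to reach
dimension `d i`. Take a product basis of each box that contains the box's indicator, drop the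
indicators, and add one stopper with all amplitudes `1`. A vector is orthogonal to this set iff it
is constant on each box and its amplitudes sum to zero.

Let such a vector be a product `x * y` across a bipartition. If a box meets the support box `s` in
the coordinates of `x` and the support box `s'` in those of `y`, it lies in the support too. A
finite check shows that the centre and any other box generate all boxes in this way. A vector
nonzero on the centre is therefore supported there alone, or is nowhere zero; in the second case
connectedness of the boxes makes both factors constant. Either way all nonzero amplitudes agree, so
their sum is not zero. Hence orthogonal product vectors vanish on the centre
(`eq_zero_of_mem_orthogonal_tilingSet`), while some orthogonal vector does not
(`exists_mem_orthogonal_tilingSet`). This gap forbids completion, and it survives local extension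
(`IsOPS.isSUCPB`).

For the UPB property one bipartition, `{0,2}|{1,3}`, suffices: there any two boxes generate
everything, so orthogonal product vectors vanish on every box. -/

/-! ### The tiling and its finite checks. -/

/-- The sides of the seventeen boxes that tile `{0, 1, 2}⁴`, as bit masks: box `r` consists of the
cells `c` such that, for every `i`, the binary digit of `tileMask r i` at position `c i` is `1`. Box `0`
is the centre. -/
def tileMask : Fin 17 → Fin 4 → ℕ :=
  ![![2, 2, 2, 2],
    ![1, 3, 1, 1], ![1, 4, 3, 1], ![1, 4, 4, 3], ![3, 4, 4, 4],
    ![4, 6, 4, 4], ![4, 1, 6, 4], ![4, 1, 1, 6], ![6, 1, 1, 1],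
    ![1, 3, 6, 3], ![3, 4, 3, 6], ![6, 6, 4, 3], ![3, 3, 6, 4],
    ![4, 6, 3, 6], ![6, 1, 6, 3], ![3, 3, 1, 6], ![6, 6, 3, 1]]

/-- Whether `v` belongs to the `i`-th side of the box `r`. -/
def tileSide (r : Fin 17) (i : Fin 4) (v : Fin 3) : Bool :=
  (tileMask r i).testBit v

/-- The bit mask of the boxes whose `i`-th side contains `v`. -/
def sliceMask : Fin 4 → Fin 3 → ℕ :=
  ![![38430, 122129, 92640],
    ![54210, 113187, 76860],
    ![107910, 95813, 23160],
    ![84750, 61065, 46320]]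

/-- The bit mask of the boxes that overlap the box `r` in the coordinate `i`. -/
def overlapMask (r : Fin 17) (i : Fin 4) : ℕ :=
  (bif tileSide r i 0 then sliceMask i 0 else 0) ||| (bif tileSide r i 1 then sliceMask i 1 else 0)
    ||| (bif tileSide r i 2 then sliceMask i 2 else 0)

/-- The bit mask of the boxes that overlap the box `r` in all coordinates of `P`. -/
def overlapMaskOn (P : Fin 4 → Bool) (r : Fin 17) : ℕ :=
  (2 ^ 17 - 1) &&& (bif P 0 then overlapMask r 0 else 2 ^ 17 - 1)
    &&& (bif P 1 then overlapMask r 1 else 2 ^ 17 - 1)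
    &&& (bif P 2 then overlapMask r 2 else 2 ^ 17 - 1)
    &&& (bif P 3 then overlapMask r 3 else 2 ^ 17 - 1)

/-- Whether some box of the set with bit mask `Z` overlaps the box `r` in all coordinates of `P`. -/
def overlapSome (P : Fin 4 → Bool) (Z : ℕ) (r : Fin 17) : Bool :=
  !(overlapMaskOn P r &&& Z).beq 0

/-- One pass over the boxes, adding to `Z` each box that passes the test `p`. -/
def growStep (p : ℕ → Fin 17 → Bool) (Z : ℕ) : ℕ :=
  (List.finRange 17).foldl (fun Z r => if p Z r then Z ||| 2 ^ (r : ℕ) else Z) Z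

/-- The boxes that must lie in the support of a product function, given that those of `Z` do. -/
def growSupport (P : Fin 4 → Bool) : ℕ → ℕ :=
  growStep fun Z r => overlapSome P Z r && overlapSome (fun i => !P i) Z r

/-- The boxes connected to those of `Z`. -/
def growClass (P : Fin 4 → Bool) : ℕ → ℕ :=
  growStep (overlapSome P)

/-- Some coordinate must be left out of `P`: boxes are disjoint, so with all four coordinates none
overlaps another. -/
theorem growClass_eq_all (P : Fin 4 → Bool) (hP : ∃ i, P i = false) :
    (growClass P)^[4] 1 = 2 ^ 17 - 1 := by
  have key : ∀ a b c d : Bool, (∃ i, ![a, b, c, d] i = false) →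
      (growClass ![a, b, c, d])^[4] 1 = 2 ^ 17 - 1 := by decide +kernel
  -- Writing `P` as four Booleans reduces the claim to the finite check `key`.
  have e : P = ![P 0, P 1, P 2, P 3] := by ext i; fin_cases i <;> rfl
  rw [e] at hP ⊢
  exact key _ _ _ _ hP

theorem growSupport_centre_eq_all (P : Fin 4 → Bool) (hP : ∃ i, P i = true)
    (hP' : ∃ i, P i = false) (s : Fin 17) (hs : s ≠ 0) :
    (growSupport P)^[5] (2 ^ ((0 : Fin 17) : ℕ) ||| 2 ^ (s : ℕ)) = 2 ^ 17 - 1 := by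
  have key : ∀ a b c d : Bool, (∃ i, ![a, b, c, d] i = true) → (∃ i, ![a, b, c, d] i = false) →
      ∀ s : Fin 17, s ≠ 0 → (growSupport ![a, b, c, d])^[5]
        (2 ^ ((0 : Fin 17) : ℕ) ||| 2 ^ (s : ℕ)) = 2 ^ 17 - 1 := by decide +kernel
  have e : P = ![P 0, P 1, P 2, P 3] := by ext i; fin_cases i <;> rfl
  rw [e] at hP hP' ⊢
  exact key _ _ _ _ hP hP' s hs

theorem growSupport_alternating_eq_all (r s : Fin 17) (h : s ≠ r) :
    (growSupport ![true, false, true, false])^[5] (2 ^ (r : ℕ) ||| 2 ^ (s : ℕ)) = 2 ^ 17 - 1 := by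
  have key : ∀ r s : Fin 17, r < s → (growSupport ![true, false, true, false])^[5]
      (2 ^ (r : ℕ) ||| 2 ^ (s : ℕ)) = 2 ^ 17 - 1 := by decide +kernel
  rcases lt_or_gt_of_ne h with h | h
  · rw [Nat.lor_comm]
    exact key s r h
  · exact key r s h

/-! ### From bit masks to cells and boxes. -/

/-- The cell `c` lies in the box `r`. -/
def InTile (r : Fin 17) (c : Fin 4 → Fin 3) : Prop :=
  ∀ i, tileSide r i (c i) = true

theorem exists_tileSide : ∀ r i, ∃ v, tileSide r i v = true := by
  decide +kernel

theorem exists_inTile (c : Fin 4 → Fin 3) : ∃ r, InTile r c := by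
  have key : ∀ a b c d : Fin 3, ∃ r, tileSide r 0 a = true ∧ tileSide r 1 b = true ∧
      tileSide r 2 c = true ∧ tileSide r 3 d = true := by decide +kernel
  obtain ⟨r, h0, h1, h2, h3⟩ := key (c 0) (c 1) (c 2) (c 3)
  refine ⟨r, fun i => ?_⟩
  fin_cases i <;> assumption

theorem exists_disjoint_side : ∀ r s : Fin 17, r ≠ s →
    ∃ i, ∀ v, ¬ (tileSide r i v = true ∧ tileSide s i v = true) := by
  decide +kernel

/-- This certifies the numerals of `sliceMask`. Only soundness is needed: a missing overlap could
only slow the growth down. -/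
theorem exists_tileSide_of_testBit : ∀ r s : Fin 17, ∀ i,
    (overlapMask r i).testBit s = true → ∃ v, tileSide r i v = true ∧ tileSide s i v = true := by
  decide +kernel

theorem exists_of_overlapSome {P : Fin 4 → Bool} {Z : ℕ} {r : Fin 17}
    (h : overlapSome P Z r = true) :
    ∃ s : Fin 17, Z.testBit s = true ∧
      ∃ c c', InTile r c ∧ InTile s c' ∧ ∀ i, P i = true → c i = c' i := by
  have hne : overlapMaskOn P r &&& Z ≠ 0 := by
    intro h0
    simp [overlapSome, h0] at h
  obtain ⟨n, hn⟩ := Nat.exists_testBit_of_ne_zero hne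
  -- The leading factor `2 ^ 17 - 1` of `overlapMaskOn` ensures that `n` is the index of a box.
  simp only [overlapMaskOn, Nat.testBit_and, Bool.and_eq_true, Nat.testBit_two_pow_sub_one,
    decide_eq_true_eq] at hn
  obtain ⟨⟨⟨⟨⟨hn17, h0⟩, h1⟩, h2⟩, h3⟩, hZ⟩ := hn
  have hP : ∀ i, P i = true → (overlapMask r i).testBit n = true := by
    intro i hi
    fin_cases i <;> simp_all
  refine ⟨⟨n, hn17⟩, hZ, ?_⟩
  have h' : ∀ i, ∃ v w, tileSide r i v = true ∧ tileSide ⟨n, hn17⟩ i w = true ∧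
      (P i = true → v = w) := by
    intro i
    by_cases hi : P i = true
    · obtain ⟨v, hv⟩ := exists_tileSide_of_testBit r ⟨n, hn17⟩ i (hP i hi)
      exact ⟨v, v, hv.1, hv.2, fun _ => rfl⟩
    · obtain ⟨v, hv⟩ := exists_tileSide r i
      obtain ⟨w, hw⟩ := exists_tileSide ⟨n, hn17⟩ i
      exact ⟨v, w, hv, hw, fun h => absurd h hi⟩
  choose c c' hc using h'
  exact ⟨c, c', fun i => (hc i).1, fun i => (hc i).2.1, fun i => (hc i).2.2⟩

theorem testBit_or_two_pow {Z : ℕ} {r s : Fin 17}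
    (h : (Z ||| 2 ^ (r : ℕ)).testBit s = true) : Z.testBit s = true ∨ s = r := by
  rw [Nat.testBit_or, Bool.or_eq_true, Nat.testBit_two_pow] at h
  exact h.imp id fun h => Fin.ext (of_decide_eq_true h).symm

/-- Turns the mask computations into proofs: a property that the test `p` propagates holds for every
box the growth reaches. -/
theorem testBit_growStep {N : Fin 17 → Prop} {p : ℕ → Fin 17 → Bool}
    (hp : ∀ Z r, (∀ s : Fin 17, Z.testBit s = true → N s) → p Z r = true → N r) (Z : ℕ)
    (hZ : ∀ s : Fin 17, Z.testBit s = true → N s) :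
    ∀ s : Fin 17, (growStep p Z).testBit s = true → N s := by
  unfold growStep
  generalize List.finRange 17 = l
  induction l generalizing Z with
  | nil => exact hZ
  | cons r l ih =>
    rw [List.foldl_cons]
    apply ih
    split_ifs with h
    · intro s hs
      rcases testBit_or_two_pow hs with hs | rfl
      exacts [hZ s hs, hp Z s hZ h]
    · exact hZ

theorem forall_of_iterate_growStep {N : Fin 17 → Prop} {p : ℕ → Fin 17 → Bool}
    (hp : ∀ Z r, (∀ s : Fin 17, Z.testBit s = true → N s) → p Z r = true → N r) {Z n : ℕ}
    (hZ : ∀ s : Fin 17, Z.testBit s = true → N s) (h : (growStep p)^[n] Z = 2 ^ 17 - 1)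
    (s : Fin 17) : N s := by
  have key : ∀ n, ∀ s : Fin 17, ((growStep p)^[n] Z).testBit s = true → N s := by
    intro n
    induction n with
    | zero => exact hZ
    | succ n ih =>
      rw [Function.iterate_succ_apply']
      exact testBit_growStep hp _ ih
  refine key n s ?_
  rw [h, Nat.testBit_two_pow_sub_one]
  exact decide_eq_true s.2

/-! ### Product functions that are constant on the boxes. -/

section ProductFunction

variable {P : Fin 4 → Bool} {x y : (Fin 4 → Fin 3) → ℂ}

/-- The cell with the coordinates in `P` of `c` and the other coordinates of `c'`. -/
def mixCells (P : Fin 4 → Bool) (c c' : Fin 4 → Fin 3) : Fin 4 → Fin 3 :=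
  fun i => if P i = true then c i else c' i

theorem InTile.mixCells {r : Fin 17} {c c' : Fin 4 → Fin 3} (hc : InTile r c) (hc' : InTile r c') :
    InTile r (mixCells P c c') := by
  intro i
  unfold _root_.mixCells
  split_ifs
  exacts [hc i, hc' i]

/-- A factor of a nowhere vanishing product function that is constant on the boxes is constant. -/
theorem factor_eq_of_ne_zero (hP : ∃ i, P i = false)
    (hx : ∀ c c', (∀ i, P i = true → c i = c' i) → x c = x c')
    (hy : ∀ c c', (∀ i, P i = false → c i = c' i) → y c = y c')
    (hxy : ∀ r c c', InTile r c → InTile r c' → x c * y c = x c' * y c') (hy0 : ∀ c, y c ≠ 0)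
    (c c' : Fin 4 → Fin 3) : x c = x c' := by
  have hconst : ∀ r c c', InTile r c → InTile r c' → x c = x c' := by
    intro r c c' hc hc'
    have h := hxy r c (mixCells P c' c) hc (hc'.mixCells hc)
    rw [hy (mixCells P c' c) c fun i hi => by simp [mixCells, hi],
      hx (mixCells P c' c) c' fun i hi => by simp [mixCells, hi]] at h
    exact mul_right_cancel₀ (hy0 c) h
  obtain ⟨c₀, hc₀⟩ : ∃ c, InTile 0 c :=
    ⟨fun i => (exists_tileSide 0 i).choose, fun i => (exists_tileSide 0 i).choose_spec⟩
  have key : ∀ r, ∀ c, InTile r c → x c = x c₀ := by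
    refine forall_of_iterate_growStep (p := overlapSome P) ?_ ?_ (growClass_eq_all P hP)
    · intro Z r hZ h c hc
      obtain ⟨s, hs, c₁, c₂, h₁, h₂, h₁₂⟩ := exists_of_overlapSome h
      rw [hconst r c c₁ hc h₁, hx c₁ c₂ h₁₂, hZ s hs c₂ h₂]
    · intro s hs c hc
      rw [Nat.testBit_one_eq_true_iff_self_eq_zero] at hs
      obtain rfl : s = 0 := Fin.ext hs
      exact hconst 0 c c₀ hc hc₀
  obtain ⟨r, hr⟩ := exists_inTile c
  obtain ⟨r', hr'⟩ := exists_inTile c'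
  rw [key r c hr, key r' c' hr']

/-- A product function constant on the boxes takes at most one nonzero value if its support contains
a box `t` that, together with any other box, generates everything. -/
theorem product_eq_zero_or_eq {t : Fin 17} (hP : ∃ i, P i = true) (hP' : ∃ i, P i = false)
    (ht : ∀ s, s ≠ t → (growSupport P)^[5] (2 ^ (t : ℕ) ||| 2 ^ (s : ℕ)) = 2 ^ 17 - 1)
    (hx : ∀ c c', (∀ i, P i = true → c i = c' i) → x c = x c')
    (hy : ∀ c c', (∀ i, P i = false → c i = c' i) → y c = y c')
    (hxy : ∀ r c c', InTile r c → InTile r c' → x c * y c = x c' * y c')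
    {c₀ : Fin 4 → Fin 3} (hc₀ : InTile t c₀) (h₀ : x c₀ * y c₀ ≠ 0) (c : Fin 4 → Fin 3) :
    x c * y c = 0 ∨ x c * y c = x c₀ * y c₀ := by
  by_cases hs : ∃ s c, s ≠ t ∧ InTile s c ∧ x c * y c ≠ 0
  · right
    obtain ⟨s, c₁, hst, hc₁, h₁⟩ := hs
    have key : ∀ r, ∀ c, InTile r c → x c * y c ≠ 0 := by
      refine forall_of_iterate_growStep
        (p := fun Z r => overlapSome P Z r && overlapSome (fun i => !P i) Z r) ?_ ?_ (ht s hst)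
      · intro Z r hZ h c hc
        rw [Bool.and_eq_true] at h
        obtain ⟨s, hs, c₁, c₂, h₁, h₂, h₁₂⟩ := exists_of_overlapSome h.1
        obtain ⟨s', hs', c₃, c₄, h₃, h₄, h₃₄⟩ := exists_of_overlapSome h.2
        -- Evaluate on the cell of `r` whose `x`-value comes from the support box `s` and whose
        -- `y`-value comes from `s'`.
        rw [hxy r c (mixCells P c₁ c₃) hc (h₁.mixCells h₃),
          hx (mixCells P c₁ c₃) c₂ fun i hi => by simp [mixCells, hi, h₁₂],
          hy (mixCells P c₁ c₃) c₄ fun i hi => by simp [mixCells, hi, h₃₄]]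
        exact mul_ne_zero (left_ne_zero_of_mul (hZ s hs c₂ h₂))
          (right_ne_zero_of_mul (hZ s' hs' c₄ h₄))
      · intro r hr c hc
        rcases testBit_or_two_pow hr with hr | rfl
        · rw [Nat.testBit_two_pow] at hr
          obtain rfl : t = r := Fin.ext (of_decide_eq_true hr)
          rwa [hxy t c c₀ hc hc₀]
        · rwa [hxy r c c₁ hc hc₁]
    have hne : ∀ c, x c * y c ≠ 0 := fun c => by
      obtain ⟨r, hr⟩ := exists_inTile c
      exact key r c hr
    rw [factor_eq_of_ne_zero hP' hx hy hxy (fun c => right_ne_zero_of_mul (hne c)) c c₀,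
      factor_eq_of_ne_zero (P := fun i => !P i) (x := y) (y := x) (by simpa using hP)
        (by simpa using hy) (by simpa using hx) (by simpa only [mul_comm] using hxy)
        (fun c => left_ne_zero_of_mul (hne c)) c c₀]
  · push Not at hs
    obtain ⟨r, hr⟩ := exists_inTile c
    by_cases hrt : r = t
    · subst hrt
      exact Or.inr (hxy r c c₀ hr hc₀)
    · exact Or.inl (hs r c hrt hr)

end ProductFunction

/-! ### Orthogonal product sets and the criterion for uncompletability. -/

section OrthogonalProductSets

variable {ι : Type*} [Fintype ι] [DecidableEq ι] {X : ι → Type*} [∀ i, Fintype (X i)]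

theorem productVector_apply (φ : ∀ i, EuclideanSpace ℂ (X i)) (x : ∀ i, X i) :
    productVector φ x = ∏ i, φ i (x i) := rfl

theorem inner_productVector (φ ψ : ∀ i, EuclideanSpace ℂ (X i)) :
    inner ℂ (productVector φ) (productVector ψ) = ∏ i, inner ℂ (φ i) (ψ i) := by
  simp only [PiLp.inner_apply, productVector_apply]
  rw [Fintype.prod_sum]
  refine Finset.sum_congr rfl fun x _ => ?_
  simp only [RCLike.inner_apply, map_prod, Finset.prod_mul_distrib]

theorem productVector_ne_zero {φ : ∀ i, EuclideanSpace ℂ (X i)} (h : ∀ i, φ i ≠ 0) :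
    productVector φ ≠ 0 := by
  intro h0
  have h1 := inner_productVector φ φ
  rw [h0, inner_zero_left] at h1
  exact Finset.prod_ne_zero_iff.2 (fun i _ => inner_self_ne_zero.2 (h i)) h1.symm

theorem mem_orthogonal_span_iff {E : Type*} [NormedAddCommGroup E] [InnerProductSpace ℂ E]
    {S : Set E} {v : E} : v ∈ (Submodule.span ℂ S)ᗮ ↔ ∀ s ∈ S, inner ℂ s v = 0 := by
  refine ⟨fun h s hs => (Submodule.mem_orthogonal _ _).1 h s (Submodule.subset_span hs),
    fun h => (Submodule.mem_orthogonal _ _).2 fun w hw => ?_⟩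
  induction hw using Submodule.span_induction with
  | mem s hs => exact h s hs
  | zero => exact inner_zero_left _
  | add a b _ _ ha hb => rw [inner_add_left, ha, hb, add_zero]
  | smul a b _ hb => rw [inner_smul_left, hb, mul_zero]

theorem IsOPS.isIncompleteOPS {S : Set (TensorSpace X)} (hS : IsOPS S) {u : TensorSpace X}
    (hu : u ∈ (Submodule.span ℂ S)ᗮ) (hu0 : u ≠ 0) : IsIncompleteOPS S := by
  refine ⟨hS, Submodule.finrank_lt fun h => hu0 ?_⟩
  rwa [h, Submodule.top_orthogonal_eq_bot, Submodule.mem_bot] at hu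

/-- An orthogonal product set is uncompletable if all product states orthogonal to it have zero
amplitude at some basis state `c`, but not all vectors orthogonal to it have. -/
theorem IsOPS.isUCPB {S : Set (TensorSpace X)} (hS : IsOPS S) {u : TensorSpace X} {c : ∀ i, X i}
    (hu : u ∈ (Submodule.span ℂ S)ᗮ) (huc : u c ≠ 0)
    (h : ∀ v ∈ (Submodule.span ℂ S)ᗮ, IsProductState v → v c = 0) : IsUCPB S := by
  classical
  refine ⟨hS.isIncompleteOPS hu fun h0 => huc (by rw [h0]; rfl), ?_⟩
  rintro ⟨T, hST, hT, hspan⟩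
  let K := Submodule.span ℂ S
  let e : TensorSpace X := EuclideanSpace.single c 1
  -- On `Kᗮ`, pairing with `a` reads off the amplitude at `c`. It vanishes on the product states
  -- that `T` adds to `S`, so `a` is orthogonal to all of `T` and is zero, contradicting `u c ≠ 0`.
  let a := Kᗮ.starProjection e
  have ha : ∀ v ∈ Kᗮ, inner ℂ v a = inner ℂ v e := by
    intro v hv
    have h1 : inner ℂ (e - a) v = 0 := Submodule.starProjection_inner_eq_zero e v hv
    have h2 : inner ℂ v (e - a) = 0 := inner_eq_zero_symm.1 h1
    rw [inner_sub_right, sub_eq_zero] at h2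
    exact h2.symm
  have he : ∀ v : TensorSpace X, inner ℂ v e = star (v c) := by
    intro v
    simp [e, EuclideanSpace.inner_single_right]
  have haT : a ∈ (Submodule.span ℂ T)ᗮ := by
    refine mem_orthogonal_span_iff.2 fun t ht => ?_
    by_cases htS : t ∈ S
    · exact mem_orthogonal_span_iff.1 (Submodule.starProjection_apply_mem Kᗮ e) t htS
    · have htK : t ∈ Kᗮ := mem_orthogonal_span_iff.2 fun s hs =>
        hT.2 (hST hs) ht fun hst => htS (hst ▸ hs)
      rw [ha t htK, he, h t htK (hT.1 t ht)]
      simp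
  rw [hspan, Submodule.top_orthogonal_eq_bot, Submodule.mem_bot] at haT
  have := ha u hu
  rw [haT, inner_zero_right, he] at this
  exact huc (star_eq_zero.1 this.symm)

/-! ### Local extensions. -/

section LocalExtension

variable {X' : ι → Type*} [∀ i, Fintype (X' i)]

/-- The part of a vector of a locally extended space on the original basis states. -/
def localRestrict (v : TensorSpace fun i => X i ⊕ X' i) : TensorSpace X :=
  WithLp.toLp 2 fun x => v fun i => Sum.inl (x i)

theorem localExtend_inl (v : TensorSpace X) (x : ∀ i, X i) :
    localExtend (X' := X') v (fun i => Sum.inl (x i)) = v x := by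
  simp [localExtend]

/-- Extension and restriction are adjoint, so orthogonality to the extended set depends only on the
restriction. -/
theorem inner_localExtend_left (s : TensorSpace X) (v : TensorSpace fun i => X i ⊕ X' i) :
    inner ℂ (localExtend s) v = inner ℂ s (localRestrict v) := by
  simp only [PiLp.inner_apply]
  symm
  refine Fintype.sum_of_injective (fun (x : ∀ i, X i) i => (Sum.inl (x i) : X i ⊕ X' i)) ?_ _ _ ?_ ?_
  · intro x x' h
    funext i
    exact Sum.inl_injective (congrFun h i)
  · intro y hy
    have : ¬ ∀ i, (y i).isLeft = true := fun h =>
      hy ⟨fun i => (y i).getLeft (h i), funext fun i => Sum.inl_getLeft _ _⟩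
    simp [localExtend, this]
  · intro x
    rw [localExtend_inl]
    rfl

theorem localRestrict_localExtend (v : TensorSpace X) :
    localRestrict (localExtend (X' := X') v) = v := by
  ext x
  exact localExtend_inl v x

theorem IsProductState.localExtend {v : TensorSpace X} (hv : IsProductState v) :
    IsProductState (localExtend (X' := X') v) := by
  obtain ⟨h0, φ, rfl⟩ := hv
  refine ⟨fun h => h0 ?_, fun i => WithLp.toLp 2 (Sum.elim (φ i) 0), ?_⟩
  · rw [← localRestrict_localExtend (X' := X') (productVector φ), h]
    rfl
  · ext y
    rw [productVector_apply]
    by_cases hy : ∀ i, (y i).isLeft = true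
    · simp only [_root_.localExtend, hy, implies_true, dite_true, productVector_apply]
      refine Finset.prod_congr rfl fun i _ => ?_
      conv_rhs => rw [← Sum.inl_getLeft (y i) (hy i)]
      rfl
    · simp only [_root_.localExtend, hy, dite_false]
      push Not at hy
      obtain ⟨i, hi⟩ := hy
      refine (Finset.prod_eq_zero (Finset.mem_univ i) ?_).symm
      obtain ⟨z, hz⟩ := Sum.isRight_iff.1 (by simpa using hi)
      rw [hz]
      rfl

theorem IsOPS.localExtend {S : Set (TensorSpace X)} (hS : IsOPS S) :
    IsOPS (localExtend (X' := X') '' S) := by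
  refine ⟨?_, ?_⟩
  · rintro _ ⟨v, hv, rfl⟩
    exact (hS.1 v hv).localExtend
  · rintro _ ⟨v, hv, rfl⟩ _ ⟨w, hw, rfl⟩ hvw
    rw [inner_localExtend_left, localRestrict_localExtend]
    exact hS.2 hv hw fun h => hvw (by rw [h])

/-- Restriction acts factor by factor; it gives zero when some factor lives on its local extension
only. -/
theorem localRestrict_productVector_eq_zero_or (φ : ∀ i, EuclideanSpace ℂ (X i ⊕ X' i)) :
    localRestrict (productVector φ) = 0 ∨ IsProductState (localRestrict (productVector φ)) := by
  refine or_iff_not_imp_left.2 fun h =>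
    ⟨h, fun i => WithLp.toLp 2 fun x => φ i (Sum.inl x), ?_⟩
  ext x
  rfl

/-- The criterion `IsOPS.isUCPB` gives strong uncompletability. -/
theorem IsOPS.isSUCPB {S : Set (TensorSpace X)} (hS : IsOPS S) {u : TensorSpace X} {c : ∀ i, X i}
    (hu : u ∈ (Submodule.span ℂ S)ᗮ) (huc : u c ≠ 0)
    (h : ∀ v ∈ (Submodule.span ℂ S)ᗮ, IsProductState v → v c = 0) : IsSUCPB S := by
  refine ⟨hS.isUCPB hu huc h, fun m => hS.localExtend.isUCPB (u := _root_.localExtend u)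
    (c := fun i => Sum.inl (c i)) ?_ ?_ ?_⟩
  · refine mem_orthogonal_span_iff.2 ?_
    rintro _ ⟨s, hs, rfl⟩
    rw [inner_localExtend_left, localRestrict_localExtend]
    exact mem_orthogonal_span_iff.1 hu s hs
  · rwa [localExtend_inl]
  · rintro v hv ⟨-, φ, rfl⟩
    rw [mem_orthogonal_span_iff, Set.forall_mem_image] at hv
    change localRestrict (productVector φ) c = 0
    rcases localRestrict_productVector_eq_zero_or φ with h0 | h0
    · rw [h0]
      rfl
    · refine h _ (mem_orthogonal_span_iff.2 fun s hs => ?_) h0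
      rw [← inner_localExtend_left]
      exact hv hs

end LocalExtension

/-! ### Regrouping of the parties as a unitary reindexing. -/

section Regroup

variable {κ : Type*} [Fintype κ] [DecidableEq κ]

/-- The basis states of the regrouped system are those of the original one. -/
def regroupEquiv (X : ι → Type*) (f : ι → κ) :
    (∀ k : κ, ∀ i : {i : ι // f i = k}, X i) ≃ ∀ i, X i where
  toFun y i := y (f i) ⟨i, rfl⟩
  invFun x _ i := x i
  left_inv y := by
    funext k ⟨i, hi⟩
    subst hi
    rfl
  right_inv _ := rfl

theorem regroup_apply (f : ι → κ) (v : TensorSpace X)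
    (y : ∀ k : κ, ∀ i : {i : ι // f i = k}, X i) : regroup f v y = v (regroupEquiv X f y) := rfl

theorem inner_regroup (f : ι → κ) (v w : TensorSpace X) :
    inner ℂ (regroup f v) (regroup f w) = inner ℂ v w := by
  simp only [PiLp.inner_apply, regroup_apply]
  exact (regroupEquiv X f).sum_comp fun x => inner ℂ (v x) (w x)

theorem exists_regroup_eq (f : ι → κ)
    (v : TensorSpace fun k : κ => ∀ i : {i : ι // f i = k}, X i) : ∃ w, regroup f w = v := by
  refine ⟨WithLp.toLp 2 fun x => v ((regroupEquiv X f).symm x), ?_⟩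
  ext y
  exact congrArg v ((regroupEquiv X f).symm_apply_apply y)

theorem regroup_ne_zero (f : ι → κ) {v : TensorSpace X} (hv : v ≠ 0) : regroup f v ≠ 0 := by
  rw [← inner_self_ne_zero (𝕜 := ℂ), inner_regroup]
  exact inner_self_ne_zero.2 hv

theorem IsProductState.regroup (f : ι → κ) {v : TensorSpace X} (hv : IsProductState v) :
    IsProductState (regroup f v) := by
  obtain ⟨h0, φ, rfl⟩ := hv
  refine ⟨regroup_ne_zero f h0,
    fun k => WithLp.toLp 2 fun z => ∏ i : {i : ι // f i = k}, φ i (z i), ?_⟩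
  ext y
  rw [regroup_apply, productVector_apply, productVector_apply, ← Fintype.prod_fiberwise f]
  refine Finset.prod_congr rfl fun k _ => Finset.prod_congr rfl ?_
  rintro ⟨i, hi⟩ -
  subst hi
  rfl

theorem IsOPS.regroup (f : ι → κ) {S : Set (TensorSpace X)} (hS : IsOPS S) :
    IsOPS (regroup f '' S) := by
  refine ⟨?_, ?_⟩
  · rintro _ ⟨v, hv, rfl⟩
    exact (hS.1 v hv).regroup f
  · rintro _ ⟨v, hv, rfl⟩ _ ⟨w, hw, rfl⟩ hvw
    rw [inner_regroup]
    exact hS.2 hv hw fun h => hvw (by rw [h])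

theorem regroup_mem_orthogonal_iff (f : ι → κ) {S : Set (TensorSpace X)} {v : TensorSpace X} :
    regroup f v ∈ (Submodule.span ℂ (regroup f '' S))ᗮ ↔ v ∈ (Submodule.span ℂ S)ᗮ := by
  simp only [mem_orthogonal_span_iff, Set.forall_mem_image, inner_regroup]

end Regroup

end OrthogonalProductSets

/-! ### Orthogonal bases adapted to a set of basis states. -/

section LocalBasis

variable {A : Type*} [DecidableEq A]

/-- The indicator vector of a set of basis states. -/
def indicatorVector (s : Finset A) : EuclideanSpace ℂ A :=
  WithLp.toLp 2 fun a => if a ∈ s then 1 else 0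

theorem indicatorVector_apply (s : Finset A) (a : A) :
    indicatorVector s a = if a ∈ s then 1 else 0 := rfl

variable [Fintype A]

/-- The vectors supported on `s` whose amplitudes add up to zero. -/
def zeroSumSubspace (s : Finset A) : Submodule ℂ (EuclideanSpace ℂ A) where
  carrier := {v | (∀ a ∉ s, v a = 0) ∧ ∑ a, v a = 0}
  zero_mem' := by simp
  add_mem' := by
    rintro v w ⟨hv, hv'⟩ ⟨hw, hw'⟩
    refine ⟨fun a ha => ?_, ?_⟩
    · rw [PiLp.add_apply, hv a ha, hw a ha, add_zero]
    · simp only [PiLp.add_apply, Finset.sum_add_distrib, hv', hw', add_zero]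
  smul_mem' := by
    rintro c v ⟨hv, hv'⟩
    refine ⟨fun a ha => ?_, ?_⟩
    · rw [PiLp.smul_apply, hv a ha, smul_zero]
    · simp only [PiLp.smul_apply, ← Finset.smul_sum, hv', smul_zero]

/-- An orthogonal basis of the vectors supported on `s`, one of which is the indicator of `s`. -/
noncomputable def indicatorBasis (s : Finset A) :
    Option (Fin (Module.finrank ℂ (zeroSumSubspace s))) → EuclideanSpace ℂ A
  | none => indicatorVector s
  | some j => stdOrthonormalBasis ℂ (zeroSumSubspace s) j

theorem indicatorBasis_some_mem (s : Finset A) (j : Fin (Module.finrank ℂ (zeroSumSubspace s))) :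
    indicatorBasis s (some j) ∈ zeroSumSubspace s :=
  (stdOrthonormalBasis ℂ (zeroSumSubspace s) j).2

theorem indicatorBasis_apply_of_notMem {s : Finset A} {a : A} (ha : a ∉ s)
    (j : Option (Fin (Module.finrank ℂ (zeroSumSubspace s)))) : indicatorBasis s j a = 0 := by
  cases j with
  | none => exact if_neg ha
  | some j => exact (indicatorBasis_some_mem s j).1 a ha

theorem inner_indicatorVector_of_mem {s : Finset A} {v : EuclideanSpace ℂ A}
    (hv : v ∈ zeroSumSubspace s) : inner ℂ (indicatorVector s) v = 0 := by
  rw [PiLp.inner_apply, ← hv.2]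
  refine Finset.sum_congr rfl fun a _ => ?_
  by_cases ha : a ∈ s
  · simp [indicatorVector_apply, ha]
  · simp [hv.1 a ha]

theorem inner_indicatorBasis {s : Finset A}
    {j k : Option (Fin (Module.finrank ℂ (zeroSumSubspace s)))} (h : j ≠ k) :
    inner ℂ (indicatorBasis s j) (indicatorBasis s k) = 0 := by
  cases j with
  | none =>
    cases k with
    | none => exact absurd rfl h
    | some k => exact inner_indicatorVector_of_mem (indicatorBasis_some_mem s k)
  | some j =>
    cases k with
    | none =>
      exact inner_eq_zero_symm.1 (inner_indicatorVector_of_mem (indicatorBasis_some_mem s j))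
    | some k =>
      exact (stdOrthonormalBasis ℂ (zeroSumSubspace s)).orthonormal.2 fun hjk => h (by rw [hjk])

theorem indicatorBasis_ne_zero {s : Finset A} (hs : s.Nonempty)
    (j : Option (Fin (Module.finrank ℂ (zeroSumSubspace s)))) : indicatorBasis s j ≠ 0 := by
  cases j with
  | none =>
    obtain ⟨a, ha⟩ := hs
    intro h
    have : indicatorVector s a = 0 := by
      change indicatorBasis s none a = 0
      rw [h]
      rfl
    simp [indicatorVector_apply, ha] at this
  | some j =>
    intro h
    exact (stdOrthonormalBasis ℂ (zeroSumSubspace s)).orthonormal.ne_zero j (Subtype.ext h)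

theorem mem_span_indicatorBasis_some {s : Finset A} {v : EuclideanSpace ℂ A}
    (hv : v ∈ zeroSumSubspace s) :
    v ∈ Submodule.span ℂ (Set.range fun j => indicatorBasis s (some j)) := by
  have h := (stdOrthonormalBasis ℂ (zeroSumSubspace s)).sum_repr ⟨v, hv⟩
  have h' := congrArg (Subtype.val) h
  rw [Submodule.coe_sum] at h'
  rw [show v = _ from h'.symm]
  exact Submodule.sum_mem _ fun j _ =>
    Submodule.smul_mem _ _ (Submodule.subset_span ⟨j, rfl⟩)

theorem mem_span_indicatorBasis {s : Finset A} {v : EuclideanSpace ℂ A}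
    (hv : ∀ a ∉ s, v a = 0) : v ∈ Submodule.span ℂ (Set.range (indicatorBasis s)) := by
  rcases s.eq_empty_or_nonempty with rfl | hs
  · rw [show v = 0 from PiLp.ext fun a => hv a (Finset.notMem_empty a)]
    exact Submodule.zero_mem _
  have hcard : (s.card : ℂ) ≠ 0 := by
    exact_mod_cast hs.card_pos.ne'
  -- The mean of `v` on `s`; subtracting it leaves a zero-sum vector.
  let m : ℂ := (∑ a, v a) / s.card
  have hw : v - m • indicatorVector s ∈ zeroSumSubspace s := by
    refine ⟨fun a ha => ?_, ?_⟩
    · simp [hv a ha, indicatorVector_apply, ha]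
    · simp [indicatorVector_apply, m, mul_div_cancel₀ _ hcard]
  rw [← sub_add_cancel v (m • indicatorVector s)]
  refine Submodule.add_mem _ (Submodule.span_mono ?_ (mem_span_indicatorBasis_some hw))
    (Submodule.smul_mem _ _ (Submodule.subset_span ⟨none, rfl⟩))
  rintro _ ⟨j, rfl⟩
  exact ⟨some j, rfl⟩

theorem inner_eq_zero_of_disjoint {s t : Finset A} (h : Disjoint s t) {v w : EuclideanSpace ℂ A}
    (hv : ∀ a ∉ s, v a = 0) (hw : ∀ a ∉ t, w a = 0) : inner ℂ v w = 0 := by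
  rw [PiLp.inner_apply]
  refine Finset.sum_eq_zero fun a _ => ?_
  by_cases ha : a ∈ s
  · rw [hw a (Finset.disjoint_left.1 h ha), inner_zero_right]
  · rw [hv a ha, inner_zero_left]

end LocalBasis

/-! ### Product bases of boxes and the stopper. -/

section Box

variable {ι : Type*} [Fintype ι] [DecidableEq ι] {X : ι → Type*} [∀ i, Fintype (X i)]

/-- The inner product of `v` with a product vector, as a multilinear map. -/
noncomputable def innerProductVector (v : TensorSpace X) :
    MultilinearMap ℂ (fun i => EuclideanSpace ℂ (X i)) ℂ :=
  ∑ x, star (v x) • (MultilinearMap.mkPiAlgebra ℂ ι ℂ).compLinearMap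
    fun i => (EuclideanSpace.proj (x i) : EuclideanSpace ℂ (X i) →L[ℂ] ℂ).toLinearMap

theorem innerProductVector_apply (v : TensorSpace X) (φ : ∀ i, EuclideanSpace ℂ (X i)) :
    innerProductVector v φ = inner ℂ v (productVector φ) := by
  simp [innerProductVector, PiLp.inner_apply, productVector_apply, mul_comm]

theorem MultilinearMap.eq_zero_of_mem_span {M : ι → Type*} [∀ i, AddCommGroup (M i)]
    [∀ i, Module ℂ (M i)] (L : MultilinearMap ℂ M ℂ) (B : ∀ i, Set (M i))
    (hL : ∀ φ, (∀ i, φ i ∈ B i) → L φ = 0) (φ : ∀ i, M i)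
    (hφ : ∀ i, φ i ∈ Submodule.span ℂ (B i)) : L φ = 0 := by
  -- Pass from generators to spans one slot at a time; `s` collects the slots already treated.
  have key : ∀ s : Finset ι, ∀ φ : ∀ i, M i, (∀ i ∈ s, φ i ∈ Submodule.span ℂ (B i)) →
      (∀ i ∉ s, φ i ∈ B i) → L φ = 0 := by
    intro s
    induction s using Finset.induction_on with
    | empty => exact fun φ _ h => hL φ fun i => h i (Finset.notMem_empty i)
    | insert i s his ih =>
      intro φ h₁ h₂
      have hi := h₁ i (Finset.mem_insert_self i s)
      rw [← Function.update_eq_self i φ]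
      generalize φ i = x₀ at hi ⊢
      induction hi using Submodule.span_induction with
      | mem x hx =>
        refine ih _ (fun k hk => ?_) fun k hk => ?_
        · have hki : k ≠ i := fun h => his (h ▸ hk)
          rw [Function.update_of_ne hki]
          exact h₁ k (Finset.mem_insert_of_mem hk)
        · rcases eq_or_ne k i with rfl | hki
          · rwa [Function.update_self]
          · rw [Function.update_of_ne hki]
            exact h₂ k (by simp [hki, hk])
      | zero => exact L.map_update_zero φ i
      | add x y _ _ hx hy => rw [L.map_update_add, hx, hy, add_zero]
      | smul c x _ hx => rw [L.map_update_smul, hx, smul_zero]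
  exact key Finset.univ φ (fun i _ => hφ i) fun i hi => absurd (Finset.mem_univ i) hi

variable [∀ i, DecidableEq (X i)]

/-- The members of the product basis of the box `∏ᵢ s i` that contains the indicator of the box. -/
noncomputable def boxBasis (s : ∀ i, Finset (X i))
    (J : ∀ i, Option (Fin (Module.finrank ℂ (zeroSumSubspace (s i))))) : TensorSpace X :=
  productVector fun i => indicatorBasis (s i) (J i)

theorem innerProductVector_single (v : TensorSpace X) (c : ∀ i, X i) :
    innerProductVector v (fun i => EuclideanSpace.single (c i) 1) = star (v c) := by
  have h : productVector (fun i => EuclideanSpace.single (c i) (1 : ℂ)) =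
      EuclideanSpace.single c 1 := by
    ext x
    rw [productVector_apply]
    by_cases hx : x = c
    · subst hx
      simp
    · obtain ⟨i, hi⟩ := Function.ne_iff.1 hx
      rw [Finset.prod_eq_zero (Finset.mem_univ i) (by simp [hi])]
      simp [hx]
  rw [innerProductVector_apply, h]
  simp [EuclideanSpace.inner_single_right]

/-- A vector orthogonal to all members of the product basis of a box except the indicator of the
box is constant on the box. -/
theorem eq_of_orthogonal_boxBasis {s : ∀ i, Finset (X i)} {v : TensorSpace X}
    (hv : ∀ J, (∃ i, J i ≠ none) → inner ℂ (boxBasis s J) v = 0) {c c' : ∀ i, X i}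
    (hc : ∀ i, c i ∈ s i) (hc' : ∀ i, c' i ∈ s i) : v c = v c' := by
  -- A product with a zero-sum factor in slot `k` expands in members with `J k ≠ none`, all
  -- orthogonal to `v`.
  have hspan : ∀ (φ : ∀ i, EuclideanSpace ℂ (X i)) (k : ι), (∀ i, ∀ a ∉ s i, φ i a = 0) →
      φ k ∈ zeroSumSubspace (s k) → innerProductVector v φ = 0 := by
    intro φ k hφ hk
    refine (innerProductVector v).eq_zero_of_mem_span
      (fun i => if i = k then Set.range fun j => indicatorBasis (s i) (some j)
        else Set.range (indicatorBasis (s i))) ?_ φ ?_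
    · intro ψ hψ
      have h : ∀ i, ∃ j, indicatorBasis (s i) j = ψ i ∧ (i = k → j ≠ none) := by
        intro i
        have := hψ i
        split_ifs at this with hik
        · obtain ⟨j, hj⟩ := this
          exact ⟨some j, hj, fun _ => Option.some_ne_none j⟩
        · obtain ⟨j, hj⟩ := this
          exact ⟨j, hj, fun h => absurd h hik⟩
      choose J hJ hJk using h
      rw [innerProductVector_apply, ← funext hJ]
      exact inner_eq_zero_symm.1 (hv J ⟨k, hJk k rfl⟩)
    · intro i
      split_ifs with hik
      · subst hik
        exact mem_span_indicatorBasis_some hk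
      · exact mem_span_indicatorBasis (hφ i)
  have hstep : ∀ (c : ∀ i, X i) (k : ι) (b : X k), (∀ i, c i ∈ s i) → b ∈ s k →
      v (Function.update c k b) = v c := by
    intro c k b hc hb
    let φ : ∀ i, EuclideanSpace ℂ (X i) := fun i => EuclideanSpace.single (c i) 1
    -- The difference of two basis states of side `k` is zero-sum, so `v` is unchanged when one
    -- coordinate moves within the box.
    have h := hspan (Function.update φ k
      (EuclideanSpace.single b 1 - EuclideanSpace.single (c k) 1)) k ?_ ?_
    · have e₁ : Function.update φ k (EuclideanSpace.single b 1) =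
          fun i => EuclideanSpace.single (Function.update c k b i) 1 := by
        funext i
        rcases eq_or_ne i k with rfl | hik
        · simp
        · simp [hik, φ]
      rw [MultilinearMap.map_update_sub, e₁, Function.update_eq_self_iff.2 rfl,
        innerProductVector_single, innerProductVector_single, sub_eq_zero] at h
      exact star_injective h
    · intro i a ha
      rcases eq_or_ne i k with rfl | hik
      · have h₁ : a ≠ b := fun h => ha (h ▸ hb)
        have h₂ : a ≠ c i := fun h => ha (h ▸ hc i)
        simp [h₁, h₂]
      · have h₂ : a ≠ c i := fun h => ha (h ▸ hc i)
        simp [hik, φ, h₂]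
    · rw [Function.update_self]
      refine ⟨fun a ha => ?_, ?_⟩
      · have h₁ : a ≠ b := fun h => ha (h ▸ hb)
        have h₂ : a ≠ c k := fun h => ha (h ▸ hc k)
        simp [h₁, h₂]
      · simp [Finset.sum_sub_distrib]
  have key : ∀ t : Finset ι, v (fun i => if i ∈ t then c' i else c i) = v c := by
    intro t
    induction t using Finset.induction_on with
    | empty => simp
    | insert k t hk ih =>
      rw [← ih, ← hstep (fun i => if i ∈ t then c' i else c i) k (c' k) ?_ (hc' k)]
      · refine congrArg v (funext fun i => ?_)
        rcases eq_or_ne i k with rfl | hik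
        · simp
        · simp [hik]
      · intro i
        split_ifs
        exacts [hc' i, hc i]
  have := key Finset.univ
  simpa using this.symm

theorem inner_boxBasis_of_ne {s : ∀ i, Finset (X i)}
    {J K : ∀ i, Option (Fin (Module.finrank ℂ (zeroSumSubspace (s i))))} (h : J ≠ K) :
    inner ℂ (boxBasis s J) (boxBasis s K) = 0 := by
  obtain ⟨i, hi⟩ := Function.ne_iff.1 h
  rw [boxBasis, boxBasis, inner_productVector]
  exact Finset.prod_eq_zero (Finset.mem_univ i) (inner_indicatorBasis hi)

theorem inner_boxBasis_of_disjoint {s t : ∀ i, Finset (X i)} (h : ∃ i, Disjoint (s i) (t i))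
    (J : ∀ i, Option (Fin (Module.finrank ℂ (zeroSumSubspace (s i)))))
    (K : ∀ i, Option (Fin (Module.finrank ℂ (zeroSumSubspace (t i))))) :
    inner ℂ (boxBasis s J) (boxBasis t K) = 0 := by
  obtain ⟨i, hi⟩ := h
  rw [boxBasis, boxBasis, inner_productVector]
  exact Finset.prod_eq_zero (Finset.mem_univ i) (inner_eq_zero_of_disjoint hi
    (fun a ha => indicatorBasis_apply_of_notMem ha _)
    fun a ha => indicatorBasis_apply_of_notMem ha _)

/-- The stopper state, all of whose amplitudes are `1`. -/
noncomputable def stopper (X : ι → Type*) [∀ i, Fintype (X i)] [∀ i, DecidableEq (X i)] :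
    TensorSpace X :=
  productVector fun _ => indicatorVector Finset.univ

theorem inner_stopper (v : TensorSpace X) : inner ℂ (stopper X) v = ∑ x, v x := by
  simp [stopper, PiLp.inner_apply, productVector_apply, indicatorVector_apply]

/-- Some factor has amplitudes that sum to zero, hence is orthogonal to the all-ones vector. -/
theorem inner_stopper_boxBasis {s : ∀ i, Finset (X i)}
    {J : ∀ i, Option (Fin (Module.finrank ℂ (zeroSumSubspace (s i))))} (h : ∃ i, J i ≠ none) :
    inner ℂ (stopper X) (boxBasis s J) = 0 := by
  obtain ⟨i, hi⟩ := h
  obtain ⟨j, hj⟩ := Option.ne_none_iff_exists'.1 hi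
  rw [stopper, boxBasis, inner_productVector]
  refine Finset.prod_eq_zero (Finset.mem_univ i) ?_
  rw [hj, PiLp.inner_apply, ← (indicatorBasis_some_mem (s i) j).2]
  simp [indicatorVector_apply]

theorem inner_stopper_boxBasis_none (s : ∀ i, Finset (X i)) :
    inner ℂ (stopper X) (boxBasis s fun _ => none) = ∏ i, ((s i).card : ℂ) := by
  rw [stopper, boxBasis, inner_productVector]
  refine Finset.prod_congr rfl fun i _ => ?_
  simp [PiLp.inner_apply, indicatorVector_apply, indicatorBasis]

end Box

/-! ### The tiling set in dimensions `d i ≥ 3`. -/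

section Tiling

variable {d : Fin 4 → ℕ}

/-- The block `0`, `1` or `2` to which a basis state of `ℂⁿ` belongs; the last block consists of all
basis states from `2` on. -/
def coarse {n : ℕ} (a : Fin n) : Fin 3 :=
  ⟨min a 2, by omega⟩

/-- The first basis state of a block. -/
def fine (hd : ∀ i, 3 ≤ d i) (i : Fin 4) (v : Fin 3) : Fin (d i) :=
  ⟨v, lt_of_lt_of_le v.2 (hd i)⟩

theorem coarse_fine (hd : ∀ i, 3 ≤ d i) (i : Fin 4) (v : Fin 3) : coarse (fine hd i v) = v :=
  Fin.ext (min_eq_left (Nat.le_of_lt_succ v.2))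

/-- The sides of the box `r` in the computational basis of `ℂ^d₁ ⊗ ⋯ ⊗ ℂ^d₄`. -/
def boxSide (d : Fin 4 → ℕ) (r : Fin 17) (i : Fin 4) : Finset (Fin (d i)) :=
  Finset.univ.filter fun a => tileSide r i (coarse a) = true

theorem mem_boxSide {r : Fin 17} {i : Fin 4} {a : Fin (d i)} :
    a ∈ boxSide d r i ↔ tileSide r i (coarse a) = true := by
  simp [boxSide]

theorem boxSide_nonempty (hd : ∀ i, 3 ≤ d i) (r : Fin 17) (i : Fin 4) :
    (boxSide d r i).Nonempty := by
  obtain ⟨v, hv⟩ := exists_tileSide r i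
  exact ⟨fine hd i v, mem_boxSide.2 (by rwa [coarse_fine])⟩

theorem exists_disjoint_boxSide {r s : Fin 17} (h : r ≠ s) :
    ∃ i, Disjoint (boxSide d r i) (boxSide d s i) := by
  obtain ⟨i, hi⟩ := exists_disjoint_side r s h
  refine ⟨i, Finset.disjoint_left.2 fun a ha ha' => hi (coarse a) ?_⟩
  exact ⟨mem_boxSide.1 ha, mem_boxSide.1 ha'⟩

/-- The product bases of all the boxes, with the indicators of the boxes replaced by the single
stopper state. -/
noncomputable def tilingSet (d : Fin 4 → ℕ) : Set (TensorSpace fun i => Fin (d i)) :=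
  insert (stopper fun i => Fin (d i))
    {v | ∃ r J, (∃ i, J i ≠ none) ∧ v = boxBasis (boxSide d r) J}

theorem inner_boxBasis_boxSide_of_ne {r s : Fin 17} (h : r ≠ s)
    (J : ∀ i, Option (Fin (Module.finrank ℂ (zeroSumSubspace (boxSide d r i)))))
    (K : ∀ i, Option (Fin (Module.finrank ℂ (zeroSumSubspace (boxSide d s i))))) :
    inner ℂ (boxBasis (boxSide d r) J) (boxBasis (boxSide d s) K) = 0 :=
  inner_boxBasis_of_disjoint (exists_disjoint_boxSide h) J K

theorem isOPS_tilingSet (hd : ∀ i, 3 ≤ d i) : IsOPS (tilingSet d) := by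
  refine ⟨?_, ?_⟩
  · rintro v (rfl | ⟨r, J, -, rfl⟩)
    · refine ⟨productVector_ne_zero fun i h => ?_, _, rfl⟩
      have := congrArg (fun w : EuclideanSpace ℂ (Fin (d i)) => w (fine hd i 0)) h
      simp [indicatorVector_apply] at this
    · exact ⟨productVector_ne_zero fun i => indicatorBasis_ne_zero (boxSide_nonempty hd r i) _,
        _, rfl⟩
  · rintro v (rfl | ⟨r, J, hJ, rfl⟩) w (rfl | ⟨s, K, hK, rfl⟩) hvw
    · exact absurd rfl hvw
    · exact inner_stopper_boxBasis hK
    · exact inner_eq_zero_symm.1 (inner_stopper_boxBasis hJ)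
    · rcases eq_or_ne r s with rfl | hrs
      · exact inner_boxBasis_of_ne fun h => hvw (by rw [h])
      · exact inner_boxBasis_boxSide_of_ne hrs J K

/-- A vector orthogonal to the tiling set that is nonzero at all basis states of the central box. -/
theorem exists_mem_orthogonal_tilingSet (hd : ∀ i, 3 ≤ d i) :
    ∃ u ∈ (Submodule.span ℂ (tilingSet d))ᗮ, ∀ c : ∀ i, Fin (d i),
      (InTile 0 fun i => coarse (c i)) → u c ≠ 0 := by
  let b (r : Fin 17) := boxBasis (boxSide d r) fun _ => none
  let n (r : Fin 17) : ℂ := ∏ i, ((boxSide d r i).card : ℂ)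
  have hn (r : Fin 17) : n r ≠ 0 := Finset.prod_ne_zero_iff.2 fun i _ => by
    exact_mod_cast (boxSide_nonempty hd r i).card_pos.ne'
  have hb : ∀ r s J, (∃ i, J i ≠ none) → inner ℂ (boxBasis (boxSide d r) J) (b s) = 0 := by
    intro r s J hJ
    rcases eq_or_ne r s with rfl | hrs
    · obtain ⟨i, hi⟩ := hJ
      exact inner_boxBasis_of_ne fun h => hi (congrFun h i)
    · exact inner_boxBasis_boxSide_of_ne hrs _ _
  -- Weighting two box indicators by each other's size makes the amplitudes sum to zero. Box `1`
  -- could be any box but the centre.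
  refine ⟨n 1 • b 0 - n 0 • b 1, mem_orthogonal_span_iff.2 ?_, fun c hc => ?_⟩
  · rintro v (rfl | ⟨r, J, hJ, rfl⟩)
    · rw [inner_sub_right, inner_smul_right, inner_smul_right, inner_stopper_boxBasis_none,
        inner_stopper_boxBasis_none, mul_comm, sub_self]
    · rw [inner_sub_right, inner_smul_right, inner_smul_right, hb r 0 J hJ, hb r 1 J hJ, mul_zero,
        mul_zero, sub_self]
  · have hbc (r : Fin 17) : b r c = ∏ i, if c i ∈ boxSide d r i then 1 else 0 := rfl
    have h0 : b 0 c = 1 := by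
      rw [hbc]
      exact Finset.prod_eq_one fun i _ => if_pos (mem_boxSide.2 (hc i))
    have h1 : b 1 c = 0 := by
      obtain ⟨i, hi⟩ := exists_disjoint_boxSide (d := d) (r := 0) (s := 1) (by decide)
      rw [hbc]
      exact Finset.prod_eq_zero (Finset.mem_univ i)
        (if_neg (Finset.disjoint_left.1 hi (mem_boxSide.2 (hc i))))
    rw [PiLp.sub_apply, PiLp.smul_apply, PiLp.smul_apply, h0, h1]
    simpa using hn 1

/-- A product function of the coordinates in `P` and the other ones that is orthogonal to the tiling
set vanishes on the box `t`. -/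
theorem eq_zero_of_mem_orthogonal_tilingSet (hd : ∀ i, 3 ≤ d i) {P : Fin 4 → Bool} {t : Fin 17}
    (hP : ∃ i, P i = true) (hP' : ∃ i, P i = false)
    (ht : ∀ s, s ≠ t → (growSupport P)^[5] (2 ^ (t : ℕ) ||| 2 ^ (s : ℕ)) = 2 ^ 17 - 1)
    {v : TensorSpace fun i => Fin (d i)} (hv : v ∈ (Submodule.span ℂ (tilingSet d))ᗮ)
    {x y : (∀ i, Fin (d i)) → ℂ} (hvxy : ∀ c, v c = x c * y c)
    (hx : ∀ c c', (∀ i, P i = true → c i = c' i) → x c = x c')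
    (hy : ∀ c c', (∀ i, P i = false → c i = c' i) → y c = y c')
    {c₀ : ∀ i, Fin (d i)} (hc₀ : InTile t fun i => coarse (c₀ i)) : v c₀ = 0 := by
  by_contra h₀
  rw [mem_orthogonal_span_iff] at hv
  have hsum : ∑ c, v c = 0 := by
    rw [← inner_stopper]
    exact hv _ (Set.mem_insert _ _)
  have hconst : ∀ r (c c' : ∀ i, Fin (d i)), (InTile r fun i => coarse (c i)) →
      (InTile r fun i => coarse (c' i)) → v c = v c' := fun r c c' hc hc' =>
    eq_of_orthogonal_boxBasis (s := boxSide d r)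
      (fun J hJ => hv _ (Set.mem_insert_of_mem _ ⟨r, J, hJ, rfl⟩))
      (fun i => mem_boxSide.2 (hc i)) fun i => mem_boxSide.2 (hc' i)
  -- Amplitudes depend only on the blocks, so the analysis on `{0,1,2}⁴` applies.
  have hcoarse : ∀ c, v c = v fun i => fine hd i (coarse (c i)) := by
    intro c
    obtain ⟨r, hr⟩ := exists_inTile fun i => coarse (c i)
    exact hconst r _ _ hr (by simpa only [coarse_fine] using hr)
  have key := product_eq_zero_or_eq (x := fun c => x fun i => fine hd i (c i))
    (y := fun c => y fun i => fine hd i (c i)) hP hP' ht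
    (fun c c' h => hx _ _ fun i hi => by rw [h i hi])
    (fun c c' h => hy _ _ fun i hi => by rw [h i hi])
    (fun r c c' hc hc' => by
      rw [← hvxy, ← hvxy]
      exact hconst r _ _ (by simpa only [coarse_fine] using hc)
        (by simpa only [coarse_fine] using hc'))
    hc₀ (by rwa [← hvxy, ← hcoarse])
  -- The sum of the amplitudes is thus `v c₀` times the size of the support, which contains `c₀`.
  have key' : ∀ c, v c = if v c = 0 then 0 else v c₀ := by
    intro c
    have h := key fun i => coarse (c i)
    rw [← hvxy, ← hvxy, ← hcoarse, ← hcoarse] at h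
    split_ifs with hc
    exacts [hc, h.resolve_left hc]
  rw [Finset.sum_congr rfl fun c _ => key' c, Finset.sum_ite, Finset.sum_const_zero, zero_add,
    Finset.sum_const, nsmul_eq_mul, mul_eq_zero] at hsum
  refine hsum.elim (fun h => ?_) h₀
  rw [Nat.cast_eq_zero, Finset.card_eq_zero] at h
  exact Finset.notMem_empty c₀ (h ▸ Finset.mem_filter.2 ⟨Finset.mem_univ c₀, h₀⟩)

theorem isUPB_tilingSet (hd : ∀ i, 3 ≤ d i) : IsUPB (tilingSet d) := by
  obtain ⟨u, hu, huc⟩ := exists_mem_orthogonal_tilingSet hd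
  have hu0 : u ≠ 0 := by
    rintro rfl
    refine huc (fun i => fine hd i 1) ?_ rfl
    simp only [coarse_fine]
    intro i
    fin_cases i <;> rfl
  refine ⟨(isOPS_tilingSet hd).isIncompleteOPS hu hu0, ?_⟩
  rintro v hv ⟨hv0, φ, rfl⟩
  refine hv0 (PiLp.ext fun c => ?_)
  obtain ⟨t, ht⟩ := exists_inTile fun i => coarse (c i)
  -- A four-partite product is also a product across `{0,2}|{1,3}`, where `t` may be any box.
  refine eq_zero_of_mem_orthogonal_tilingSet hd (P := ![true, false, true, false]) ⟨0, rfl⟩ ⟨1, rfl⟩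
    (growSupport_alternating_eq_all t) hv (x := fun c => φ 0 (c 0) * φ 2 (c 2))
    (y := fun c => φ 1 (c 1) * φ 3 (c 3)) (fun c => ?_) (fun c c' h => ?_) (fun c c' h => ?_) ht
  · rw [productVector_apply, Fin.prod_univ_four]
    ring
  · dsimp only
    rw [h 0 rfl, h 2 rfl]
  · dsimp only
    rw [h 1 rfl, h 3 rfl]

theorem isSUCPB_regroup_tilingSet (hd : ∀ i, 3 ≤ d i) (f : Fin 4 → Fin 2)
    (hf : Function.Surjective f) : IsSUCPB (regroup f '' tilingSet d) := by
  obtain ⟨u, hu, huc⟩ := exists_mem_orthogonal_tilingSet hd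
  have hcentre : InTile 0 fun i => coarse (fine hd i 1) := by
    simp only [coarse_fine]
    intro i
    fin_cases i <;> rfl
  -- The criterion is applied at the central cell, whose coordinates all equal `1`.
  refine ((isOPS_tilingSet hd).regroup f).isSUCPB (u := regroup f u)
    (c := fun k i => fine hd i 1) ((regroup_mem_orthogonal_iff f).2 hu) (huc _ hcentre) ?_
  rintro v hv ⟨-, φ, hφ⟩
  obtain ⟨w, rfl⟩ := exists_regroup_eq (X := fun i => Fin (d i)) f v
  rw [regroup_mem_orthogonal_iff] at hv
  obtain ⟨i₀, hi₀⟩ := hf 0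
  obtain ⟨i₁, hi₁⟩ := hf 1
  refine eq_zero_of_mem_orthogonal_tilingSet hd (P := fun i => decide (f i = 0))
    ⟨i₀, by simp [hi₀]⟩ ⟨i₁, by simp [hi₁]⟩
    (growSupport_centre_eq_all _ ⟨i₀, by simp [hi₀]⟩ ⟨i₁, by simp [hi₁]⟩) hv
    (x := fun c => φ 0 fun i => c i) (y := fun c => φ 1 fun i => c i)
    (fun c => ?_) (fun c c' h => ?_) (fun c c' h => ?_) hcentre
  · have h := congrFun (congrArg WithLp.ofLp hφ) fun k i => c i
    rwa [productVector_apply, Fin.prod_univ_two] at h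
  · exact congrArg (φ 0) (funext fun i => h i (by simp [i.2]))
  · exact congrArg (φ 1) (funext fun i => h i (by simp [i.2]))

end Tiling

/-- For all `d₁, …, d₄ ≥ 3` there is a UPB in `ℂ^d₁ ⊗ ⋯ ⊗ ℂ^d₄` that is an SUCPB in every
bipartition of the four parties. A bipartition is given by a surjection `f` onto two new parties,
i.e. by the two nonempty disjoint groups `{i | f i = 0}` and `{i | f i = 1}`. -/
theorem theorem2 (d : Fin 4 → ℕ) (hd : ∀ i, 3 ≤ d i) :
    ∃ S : Set (TensorSpace fun i => Fin (d i)),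
      IsUPB S ∧
        ∀ f : Fin 4 → Fin 2, Function.Surjective f → IsSUCPB (regroup f '' S) :=
  ⟨tilingSet d, isUPB_tilingSet hd, isSUCPB_regroup_tilingSet hd⟩
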